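/- **Conventions.** A *partial applicative structure* is a set $\mathcal{A}$ with a partial binary operation $(a,b)\mapsto a\cdot b$; application associates to the left. Write $a\cdot b{\downarrow}$ if $a\cdot b$ is defined and $a\cdot b{\uparrow}$ otherwise. *Closed terms* over $\mathcal{A}$ are built from the elements of $\mathcal{A}$ by formal application $(s,t)\mapsto st$; a closed term is defined iff all its subterms are. Write $s\simeq t$ if $s$ and $t$ are both undefined, or both are defined with the same value. For ordinals $\alpha$, the relations $\sim_\alpha$ on closed terms over $\mathcal{A}$ are defined by transfinite recursion: $s\sim_0 t$ iff $s\simeq t$; $s\sim_{\alpha+1}t$ iff $sx\sim_\alpha tx$ for all $x\in\mathcal{A}$; and, for $\alpha$ a limit ordinal, $s\sim_\alpha t$ iff $s\sim_\beta t$ for some $\beta<\alpha$. An *embedding* $F:\mathcal{A}\to\mathcal{B}$ is an injective map such that for all $a,b,c\in\mathcal{A}$: if $a\cdot b{\downarrow}=c$, then $F(a)\cdot F(b){\downarrow}=F(c)$; and if $a\cdot b{\uparrow}$, then $F(a)\cdot F(b){\uparrow}$. It extends to closed terms by $F(st)=F(s)F(t)$. *Kleene's first model* $\mathcal{K}_1$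 is $\omega$ with $n\cdot m=\Phi_n(m)$, where $\Phi_n$ is the $n$th partial computable function. For $X\subseteq\omega$, $\mathcal{K}_1^X$ is $\omega$ with $n\cdot m=\Phi_n^X(m)$, where $\Phi_n^X$ is the $n$th partial function computable with oracle $X$. *Kleene's second model* $\mathcal{K}_2$ is $\omega^\omega$ with $$(f\cdot g)(n)=f(\langle n,g(0),\dots,g(r-1)\rangle)-1\quad\text{for the least } r \text{ with } f(\langle n,g(0),\dots,g(r-1)\rangle)>0,$$ where $f\cdot g$ is defined iff such an $r$ exists for every $n$, and $\langle\cdot\rangle$ is a fixed computable bijection from finite sequences of natural numbers to $\omega$ that sends the empty sequence to $0$. A map $F:\omega\to\omega^\omega$ is *$X$-computable* (*computable*) if the function $(n,k)\mapsto F(n)(k)$ is $X$-computable (computable). **Theorem.** For every $X\subseteq\omega$ there is an $X$-computable embedding $F:\mathcal{K}_1^X\to\mathcal{K}_2$ such that, for all ordinals $\alpha$ and all closed terms $s,t$ over $\mathcal{K}_1^X$, $$s\sim_\alpha t \text{ in } \mathcal{K}_1^X \iff F(s)\sim_\alpha F(t)\text{ in }\mathcal{K}_2.$$ Likewise, there is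 a computable embedding $F:\mathcal{K}_1\to\mathcal{K}_2$ such that, for all ordinals $\alpha$ and all closed terms $s,t$ over $\mathcal{K}_1$, $s\sim_\alpha t$ in $\mathcal{K}_1$ iff $F(s)\sim_\alpha F(t)$ in $\mathcal{K}_2$. -/

import Mathlib

universe u v

/-! ## Partial applicative structures, closed terms, higher extensionality -/

/-- A partial applicative structure with underlying set `A`. -/
structure PartialApplicativeStructure (A : Type u) where
  /-- The partial application operation `(a, b) ↦ a · b`. -/
  app : A → A → Part A

/-- Closed terms over `A`: elements of `A`, closed under formal application. -/
inductive ClosedTerm (A : Type u) : Type u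
  | elem (a : A) : ClosedTerm A
  | app (s t : ClosedTerm A) : ClosedTerm A

namespace ClosedTerm

/-- The value of a closed term. A term is defined only if all its subterms are. -/
def value {A : Type u} (P : PartialApplicativeStructure A) : ClosedTerm A → Part A
  | elem a => Part.some a
  | app s t => (value P s).bind fun a => (value P t).bind fun b => P.app a b

/-- The extension of a map `F : A → B` to closed terms, with `F(st) = F(s)F(t)`. -/
def map {A : Type u} {B : Type v} (F : A → B) : ClosedTerm A → ClosedTerm B
  | elem a => elem (F a)
  | app s t => app (map F s) (map F t)

end ClosedTerm

namespace PartialApplicativeStructure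

/-- Kleene equality `s ≃ t`: both terms are undefined, or both are defined and have the same
value. -/
def KleeneEq {A : Type u} (P : PartialApplicativeStructure A) (s t : ClosedTerm A) : Prop :=
  s.value P = t.value P

/-- The relation `s ∼_α t` on closed terms, by transfinite recursion on `α`:
`∼_0` is Kleene equality; `s ∼_{α+1} t` iff `s x ∼_α t x` for all elements `x`; and for a limit `α`,
`s ∼_α t` iff `s ∼_β t` for some `β < α`. -/
noncomputable def ExtEq {A : Type u} (P : PartialApplicativeStructure A) (α : Ordinal.{v}) :
    ClosedTerm A → ClosedTerm A → Prop :=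
  Ordinal.limitRecOn (motive := fun _ => ClosedTerm A → ClosedTerm A → Prop) α
    (fun s t => P.KleeneEq s t)
    (fun _ R s t => ∀ x : A, R (s.app (.elem x)) (t.app (.elem x)))
    (fun α _ R s t => ∃ β, ∃ h : β < α, R β h s t)

theorem extEq_zero {A : Type u} (P : PartialApplicativeStructure A) (s t : ClosedTerm A) :
    P.ExtEq (0 : Ordinal.{v}) s t ↔ P.KleeneEq s t := by
  simp [ExtEq]

theorem extEq_add_one {A : Type u} (P : PartialApplicativeStructure A) (α : Ordinal.{v})
    (s t : ClosedTerm A) :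
    P.ExtEq (α + 1) s t ↔ ∀ x : A, P.ExtEq α (s.app (.elem x)) (t.app (.elem x)) := by
  simp [ExtEq]

theorem extEq_limit {A : Type u} (P : PartialApplicativeStructure A) (α : Ordinal.{v})
    (hα : Order.IsSuccLimit α) (s t : ClosedTerm A) :
    P.ExtEq α s t ↔ ∃ β < α, P.ExtEq β s t := by
  simp [ExtEq, Ordinal.limitRecOn_limit _ _ _ _ hα]

/-- `F : A → B` is an embedding of `P` into `Q`: it is injective, `a · b = c` implies
`F(a) · F(b) = F(c)`, and if `a · b` is undefined, then so is `F(a) · F(b)`. -/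
structure IsEmbedding {A : Type u} {B : Type v} (P : PartialApplicativeStructure A)
    (Q : PartialApplicativeStructure B) (F : A → B) : Prop where
  injective : Function.Injective F
  map_defined : ∀ a b c : A, c ∈ P.app a b → F c ∈ Q.app (F a) (F b)
  map_undefined : ∀ a b : A, ¬ (P.app a b).Dom → ¬ (Q.app (F a) (F b)).Dom

end PartialApplicativeStructure

/-! ## Oracle computations -/

/-- Programs for partial functions `ℕ → ℕ` that are computable with an oracle. -/
inductive OracleCode : Type
  | zero : OracleCode
  | succ : OracleCode
  | left : OracleCode
  | right : OracleCode
  | oracle : OracleCode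
  | pair : OracleCode → OracleCode → OracleCode
  | comp : OracleCode → OracleCode → OracleCode
  | prec : OracleCode → OracleCode → OracleCode
  | rfind' : OracleCode → OracleCode

namespace OracleCode

/-- The partial function computed by a program when the oracle is `O : ℕ → ℕ`. All clauses but
`oracle` are those of `Nat.Partrec.Code.eval`. -/
def eval (O : ℕ → ℕ) : OracleCode → ℕ →. ℕ
  | zero => pure 0
  | succ => Nat.succ
  | left => ↑fun n : ℕ => n.unpair.1
  | right => ↑fun n : ℕ => n.unpair.2
  | oracle => O
  | pair cf cg => fun n => Nat.pair <$> eval O cf n <*> eval O cg n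
  | comp cf cg => fun n => eval O cg n >>= eval O cf
  | prec cf cg =>
    Nat.unpaired fun a n =>
      n.rec (eval O cf a) fun y IH => do
        let i ← IH
        eval O cg (Nat.pair a (Nat.pair y i))
  | rfind' cf =>
    Nat.unpaired fun a m =>
      (Nat.rfind fun n => (fun m => m = 0) <$> eval O cf (Nat.pair a (n + m))).map (· + m)

/-- The Gödel number of a program. -/
def encodeCode : OracleCode → ℕ
  | zero => 0
  | succ => 1
  | left => 2
  | right => 3
  | oracle => 4
  | pair cf cg => 2 * (2 * Nat.pair (encodeCode cf) (encodeCode cg)) + 5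
  | comp cf cg => 2 * (2 * Nat.pair (encodeCode cf) (encodeCode cg) + 1) + 5
  | prec cf cg => (2 * (2 * Nat.pair (encodeCode cf) (encodeCode cg)) + 1) + 5
  | rfind' cf => (2 * (2 * encodeCode cf + 1) + 1) + 5

/-- The program with a given Gödel number; every natural number is one. -/
def ofNatCode : ℕ → OracleCode
  | 0 => zero
  | 1 => succ
  | 2 => left
  | 3 => right
  | 4 => oracle
  | n + 5 =>
    let m := n.div2.div2
    have hm : m < n + 5 := by simp only [m, Nat.div2_val]; omega
    have _m1 : m.unpair.1 < n + 5 := lt_of_le_of_lt m.unpair_left_le hm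
    have _m2 : m.unpair.2 < n + 5 := lt_of_le_of_lt m.unpair_right_le hm
    match n.bodd, n.div2.bodd with
    | false, false => pair (ofNatCode m.unpair.1) (ofNatCode m.unpair.2)
    | false, true => comp (ofNatCode m.unpair.1) (ofNatCode m.unpair.2)
    | true, false => prec (ofNatCode m.unpair.1) (ofNatCode m.unpair.2)
    | true, true => rfind' (ofNatCode m)
  termination_by n => n
  decreasing_by all_goals first | exact _m1 | exact _m2 | exact hm

theorem ofNatCode_encodeCode (c : OracleCode) : ofNatCode (encodeCode c) = c := by
  induction c <;> simp [encodeCode, ofNatCode, Nat.div2_val, *]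

theorem encodeCode_ofNatCode : ∀ n, encodeCode (ofNatCode n) = n
  | 0 => by simp [ofNatCode, encodeCode]
  | 1 => by simp [ofNatCode, encodeCode]
  | 2 => by simp [ofNatCode, encodeCode]
  | 3 => by simp [ofNatCode, encodeCode]
  | 4 => by simp [ofNatCode, encodeCode]
  | n + 5 => by
    let m := n.div2.div2
    have hm : m < n + 5 := by simp only [m, Nat.div2_val]; omega
    have _m1 : m.unpair.1 < n + 5 := lt_of_le_of_lt m.unpair_left_le hm
    have _m2 : m.unpair.2 < n + 5 := lt_of_le_of_lt m.unpair_right_le hm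
    have IH := encodeCode_ofNatCode m
    have IH1 := encodeCode_ofNatCode m.unpair.1
    have IH2 := encodeCode_ofNatCode m.unpair.2
    conv_rhs => rw [← Nat.bit_bodd_div2 n, ← Nat.bit_bodd_div2 n.div2]
    simp only [ofNatCode.eq_6]
    cases n.bodd <;> cases n.div2.bodd <;>
      simp [m, encodeCode, IH, IH1, IH2, Nat.bit_val]
  termination_by n => n
  decreasing_by all_goals first | exact _m1 | exact _m2 | exact hm

instance instDenumerable : Denumerable OracleCode :=
  Denumerable.mk' ⟨encodeCode, ofNatCode, ofNatCode_encodeCode, encodeCode_ofNatCode⟩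

end OracleCode

/-- The characteristic function of a set of natural numbers. -/
noncomputable def charFun (X : Set ℕ) : ℕ → ℕ :=
  X.indicator fun _ => 1

/-! ## Kleene's models -/

/-- Kleene's first model: `ℕ` with `n · m = Φ_n(m)`. -/
def kleeneOne : PartialApplicativeStructure ℕ where
  app n m := (Denumerable.ofNat Nat.Partrec.Code n).eval m

/-- Kleene's first model relativized to `X`: `ℕ` with `n · m = Φ_n^X(m)`. -/
noncomputable def kleeneOneRel (X : Set ℕ) : PartialApplicativeStructure ℕ where
  app n m := (Denumerable.ofNat OracleCode n).eval (charFun X) m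

/-- The code of the finite sequence `n, g(0), …, g(r - 1)`, under a computable bijection between
finite sequences and natural numbers that assigns `0` to the empty sequence. -/
def kleeneQuery (g : ℕ → ℕ) (n r : ℕ) : ℕ :=
  Encodable.encode (n :: (List.range r).map g)

/-- Kleene's second model: Baire space with `(f · g)(n) = f⟨n, g(0), …, g(r - 1)⟩ - 1` for the
least `r` with `f⟨n, g(0), …, g(r - 1)⟩ > 0`; `f · g` is defined iff such an `r` exists for
every `n`. -/
def kleeneTwo : PartialApplicativeStructure (ℕ → ℕ) where
  app f g :=
    { Dom := ∀ n, ∃ r, 0 < f (kleeneQuery g n r)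
      get := fun h n => f (kleeneQuery g n (Nat.find (h n))) - 1 }

open Nat.Partrec (Code)


/-! ## Higher extensionality -/

/-! It suffices to find `F` with `F n 0 = n` and `F n · g = F (n · g 0)` for every `g`, both sides
being defined together (`kleeneTwo_embedding_of_app_eq`). Evaluation at `0` then makes `F`
injective, and applying `F s` to an arbitrary `g` has the same effect as applying it to `F (g 0)`.
Quantifying over Baire space in the successor clause is thus the same as quantifying over `ℕ`, and
induction on `α` transfers every `∼_α`.

Such an `F` is defined by recursion on the query. The code `0` is never queried, so it can store
`n`. On a query `j, m, l'`, run `n · m` up to stage `l'.length`: answer `0` if there is no value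
yet, and `F y j + 1` if the value is `y`. The entries of `l'` only serve as a clock. The recursion
is well founded because `j` is less than the code of the query (`stageEmbedding`,
`kleeneTwo_app_stageEmbedding`).

For computability, `F n k` looks only at stages up to `k`. With an oracle, stage `r` uses only
oracle values below `r`, so `F n k` is primitive recursive in `n`, `k` and the first `k` values of
the oracle. Such stages exist by the use principle: a halting computation consults finitely many
oracle values (`eventually_mem_evalPart`, `mem_eval_iff_exists_evalStage`). -/

theorem ClosedTerm.value_app_congr {A : Type u} {P : PartialApplicativeStructure A}
    {s s' : ClosedTerm A} (h : s.value P = s'.value P) (t : ClosedTerm A) :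
    (s.app t).value P = (s'.app t).value P := by
  simp only [ClosedTerm.value, h]

/-- Used to exchange `F(s) g`, with `g` outside the range of `F`, for the image of `s (g 0)`. -/
theorem PartialApplicativeStructure.extEq_congr {A : Type u} (P : PartialApplicativeStructure A)
    (α : Ordinal.{v}) : ∀ {s s' t t' : ClosedTerm A}, s.value P = s'.value P →
      t.value P = t'.value P → (P.ExtEq α s t ↔ P.ExtEq α s' t') := by
  induction α using Ordinal.limitRecOn with
  | zero => intro s s' t t' hs ht; simp only [P.extEq_zero, KleeneEq, hs, ht]
  | add_one α ih =>
    intro s s' t t' hs ht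
    simp only [P.extEq_add_one]
    exact forall_congr' fun x =>
      ih (ClosedTerm.value_app_congr hs _) (ClosedTerm.value_app_congr ht _)
  | limit α hα ih =>
    intro s s' t t' hs ht
    simp only [P.extEq_limit α hα]
    exact exists_congr fun β => and_congr_right fun hβ => ih β hβ hs ht

/-- If application of `F n` to `g` only depends on `g 0` and is the image of `n · g 0`, and if
`F` is a section of evaluation at `0`, then `F` is an embedding into Kleene's second model that
preserves and reflects all the relations `∼_α`. -/
theorem kleeneTwo_embedding_of_app_eq {P : PartialApplicativeStructure ℕ} {F : ℕ → ℕ → ℕ}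
    (h0 : ∀ n, F n 0 = n) (happ : ∀ n g, kleeneTwo.app (F n) g = (P.app n (g 0)).map F) :
    P.IsEmbedding kleeneTwo F ∧ ∀ (α : Ordinal.{u}) (s t : ClosedTerm ℕ),
      P.ExtEq α s t ↔ kleeneTwo.ExtEq α (s.map F) (t.map F) := by
  have hinj : Function.Injective F := fun a b hab => by rw [← h0 a, ← h0 b, hab]
  have hval : ∀ s : ClosedTerm ℕ, (s.map F).value kleeneTwo = (s.value P).map F := by
    intro s
    induction s with
    | elem a => simp [ClosedTerm.map, ClosedTerm.value]
    | app s t ihs iht =>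
      simp only [ClosedTerm.map, ClosedTerm.value, ihs, iht, Part.bind_map, happ, h0,
        Part.map_bind]
  have hfirst : ∀ (s : ClosedTerm ℕ) (g : ℕ → ℕ),
      ((s.map F).app (.elem g)).value kleeneTwo =
        ((s.app (.elem (g 0))).map F).value kleeneTwo := by
    intro s g
    simp only [ClosedTerm.map, ClosedTerm.value, hval, Part.bind_map, Part.bind_some, happ, h0]
  refine ⟨⟨hinj, fun a b c hc => ?_, fun a b hab => ?_⟩, fun α => ?_⟩
  · rw [happ, h0]
    exact Part.mem_map F hc
  · rw [happ, h0]
    exact hab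
  · induction α using Ordinal.limitRecOn with
    | zero =>
      intro s t
      simp only [PartialApplicativeStructure.extEq_zero, PartialApplicativeStructure.KleeneEq, hval]
      -- Reflecting Kleene equality is where injectivity of `F` enters.
      refine ⟨fun h => by rw [h], fun h => Part.ext fun a => ?_⟩
      have := congrArg (F a ∈ ·) h
      simpa [Part.mem_map_iff, hinj.eq_iff] using this
    | add_one α ih =>
      intro s t
      simp only [PartialApplicativeStructure.extEq_add_one, ih]
      constructor
      · intro h g
        exact (kleeneTwo.extEq_congr α (hfirst s g) (hfirst t g)).2 (h (g 0))
      · intro h x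
        exact h (F x)
    | limit α hα ih =>
      intro s t
      simp only [PartialApplicativeStructure.extEq_limit _ α hα]
      exact exists_congr fun β => and_congr_right fun hβ => ih β hβ s t

/-! ## The embedding attached to a stagewise approximation of application -/

/-- The recursive call made by `stageEmbedding W n` at the sequence `l`: if `l` is
`j, m, l'` and `W n m` has converged to `y` at stage `l'.length`, the call is at `(y, j)`. -/
def stageCall (W : ℕ → ℕ → ℕ → Option ℕ) (n : ℕ) : List ℕ → Option (ℕ × ℕ)
  | j :: m :: l => (W n m l.length).map fun y => (y, j)
  | _ => none

theorem lt_encode_of_mem_stageCall {W : ℕ → ℕ → ℕ → Option ℕ} {n k : ℕ} {p : ℕ × ℕ}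
    (h : p ∈ stageCall W n (Denumerable.ofNat (List ℕ) k)) : p.2 < k := by
  rw [← Denumerable.encode_ofNat (α := List ℕ) k]
  generalize Denumerable.ofNat (List ℕ) k = l at h ⊢
  match l, h with
  | j :: m :: l, h =>
    obtain ⟨y, -, rfl⟩ := Option.map_eq_some_iff.1 h
    rw [Encodable.encode_list_cons]
    exact Nat.lt_succ_of_le (Nat.left_le_pair _ _)

/-- The map `ℕ → ℕ^ℕ` such that `stageEmbedding W n · g` is the image of the limit of
`W n (g 0)`. -/
def stageEmbedding (W : ℕ → ℕ → ℕ → Option ℕ) (n k : ℕ) : ℕ :=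
  if k = 0 then n
  else
    match h : stageCall W n (Denumerable.ofNat (List ℕ) k) with
    | none => 0
    | some p =>
      have : p.2 < k := lt_encode_of_mem_stageCall h
      stageEmbedding W p.1 p.2 + 1
  termination_by k

theorem stageEmbedding_zero (W : ℕ → ℕ → ℕ → Option ℕ) (n : ℕ) : stageEmbedding W n 0 = n := by
  rw [stageEmbedding, if_pos rfl]

theorem stageEmbedding_of_ne_zero (W : ℕ → ℕ → ℕ → Option ℕ) (n : ℕ) {k : ℕ} (hk : k ≠ 0) :
    stageEmbedding W n k = ((stageCall W n (Denumerable.ofNat (List ℕ) k)).map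
      fun p => stageEmbedding W p.1 p.2 + 1).getD 0 := by
  rw [stageEmbedding, if_neg hk]
  split <;> simp [*]

theorem stageEmbedding_query_zero (W : ℕ → ℕ → ℕ → Option ℕ) (n : ℕ) (g : ℕ → ℕ) (j : ℕ) :
    stageEmbedding W n (kleeneQuery g j 0) = 0 := by
  rw [stageEmbedding_of_ne_zero _ _ (by simp [kleeneQuery]), kleeneQuery, Denumerable.ofNat_encode]
  rfl

theorem stageEmbedding_query_succ (W : ℕ → ℕ → ℕ → Option ℕ) (n : ℕ) (g : ℕ → ℕ) (j r : ℕ) :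
    stageEmbedding W n (kleeneQuery g j (r + 1)) =
      ((W n (g 0) r).map fun y => stageEmbedding W y j + 1).getD 0 := by
  rw [stageEmbedding_of_ne_zero _ _ (by simp [kleeneQuery]), kleeneQuery, Denumerable.ofNat_encode,
    List.range_succ_eq_map]
  simp [stageCall, Function.comp_def]

/-- Reading `r + 1` entries of `g` supplies `g 0` and the stage `r`. The stages need not be
monotone: application is single-valued, so all stages that give a value give the same one, and the
least successful query is as good as any other. -/
theorem kleeneTwo_app_stageEmbedding {P : PartialApplicativeStructure ℕ}
    {W : ℕ → ℕ → ℕ → Option ℕ} (hW : ∀ n m y, y ∈ P.app n m ↔ ∃ r, y ∈ W n m r)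
    (n : ℕ) (g : ℕ → ℕ) :
    kleeneTwo.app (stageEmbedding W n) g = (P.app n (g 0)).map (stageEmbedding W) := by
  have hpos : ∀ j q, 0 < stageEmbedding W n (kleeneQuery g j q) →
      ∃ y ∈ P.app n (g 0), stageEmbedding W n (kleeneQuery g j q) = stageEmbedding W y j + 1 := by
    intro j q hq
    cases q with
    | zero => simp [stageEmbedding_query_zero] at hq
    | succ r =>
      rw [stageEmbedding_query_succ] at hq ⊢
      cases hy : W n (g 0) r with
      | none => simp [hy] at hq
      | some y => exact ⟨y, (hW _ _ _).2 ⟨r, hy⟩, rfl⟩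
  have hdom : (P.app n (g 0)).Dom → ∀ j, ∃ q, 0 < stageEmbedding W n (kleeneQuery g j q) := by
    intro h j
    obtain ⟨r, hr⟩ := (hW n (g 0) _).1 (Part.get_mem h)
    refine ⟨r + 1, ?_⟩
    rw [stageEmbedding_query_succ, Option.mem_def.1 hr]
    exact Nat.succ_pos _
  refine Part.ext' ⟨fun h => ?_, fun h => hdom h⟩ fun h₁ h₂ => funext fun j => ?_
  -- One coordinate is enough, since whether a query succeeds does not depend on `j`.
  · obtain ⟨q, hq⟩ := h 0
    obtain ⟨y, hy, -⟩ := hpos 0 q hq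
    exact Part.dom_iff_mem.2 ⟨_, Part.mem_map _ hy⟩
  · obtain ⟨y, hy, h⟩ := hpos j _ (Nat.find_spec (h₁ j))
    change stageEmbedding W n (kleeneQuery g j (Nat.find (h₁ j))) - 1 = _
    rw [h, ← Part.get_eq_of_mem hy h₂]
    rfl

theorem stageEmbedding_congr {W W' : ℕ → ℕ → ℕ → Option ℕ} {n k : ℕ}
    (h : ∀ n m, ∀ r ≤ k, W n m r = W' n m r) : stageEmbedding W n k = stageEmbedding W' n k := by
  induction k using Nat.strong_induction_on generalizing n with
  | _ k ih =>
    rcases eq_or_ne k 0 with rfl | hk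
    · simp only [stageEmbedding_zero]
    have hcall : stageCall W n (Denumerable.ofNat (List ℕ) k) =
        stageCall W' n (Denumerable.ofNat (List ℕ) k) := by
      -- A list is no longer than its code, so the stage consulted is below `k`.
      have hlen := Encodable.length_le_encode (Denumerable.ofNat (List ℕ) k)
      rw [Denumerable.encode_ofNat] at hlen
      generalize Denumerable.ofNat (List ℕ) k = l at hlen
      match l, hlen with
      | [], _ | [_], _ => rfl
      | _ :: _ :: l, hlen =>
        simp only [List.length_cons] at hlen
        simp only [stageCall, h _ _ l.length (by omega)]
    rw [stageEmbedding_of_ne_zero _ _ hk, stageEmbedding_of_ne_zero _ _ hk, hcall]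
    congr 1
    refine Option.map_congr fun p hp => ?_
    have hlt := lt_encode_of_mem_stageCall hp
    rw [ih _ hlt fun n m r hr => h n m r (hr.trans hlt.le)]

theorem primrec_stageCall {α : Type*} [Primcodable α] {W : α → ℕ → ℕ → ℕ → Option ℕ}
    (hW : Primrec fun p : α × ℕ × ℕ × ℕ => W p.1 p.2.1 p.2.2.1 p.2.2.2) :
    Primrec fun p : α × ℕ × List ℕ => stageCall (W p.1) p.2.1 p.2.2 := by
  open Primrec in
  have hl : Primrec fun p : α × ℕ × List ℕ => p.2.2 := snd.comp snd
  have hm : Primrec fun p : α × ℕ × List ℕ => p.2.2.tail.head? := list_head?.comp (list_tail.comp hl)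
  have hj : Primrec fun p : α × ℕ × List ℕ => p.2.2.headI := list_headI.comp hl
  have hr : Primrec fun p : α × ℕ × List ℕ => p.2.2.tail.tail.length :=
    list_length.comp (list_tail.comp (list_tail.comp hl))
  have hw : Primrec₂ fun (p : α × ℕ × List ℕ) (m : ℕ) =>
      (W p.1 p.2.1 m p.2.2.tail.tail.length).map fun y => (y, p.2.2.headI) :=
    option_map
      (hW.comp (pair (fst.comp fst) (pair (fst.comp (snd.comp fst)) (pair snd (hr.comp fst)))))
      (pair snd (hj.comp (fst.comp fst))).to₂
  refine (option_bind hm hw).of_eq fun p => ?_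
  obtain ⟨a, n, l⟩ := p
  rcases l with - | ⟨j, - | ⟨m, l⟩⟩ <;> rfl

/-- The recursive call changes `n` as well as `k`, so the recursion runs over pairs with measure
`k`, each pair making at most one call. -/
theorem primrec_stageEmbedding {α : Type*} [Primcodable α] {W : α → ℕ → ℕ → ℕ → Option ℕ}
    (hW : Primrec fun p : α × ℕ × ℕ × ℕ => W p.1 p.2.1 p.2.2.1 p.2.2.2) :
    Primrec fun p : α × ℕ × ℕ => stageEmbedding (W p.1) p.2.1 p.2.2 := by
  open Primrec in
  have hcall : Primrec fun p : α × ℕ × ℕ =>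
      stageCall (W p.1) p.2.1 (Denumerable.ofNat (List ℕ) p.2.2) :=
    (primrec_stageCall hW).comp
      (pair fst (pair (fst.comp snd) ((Primrec.ofNat _).comp (snd.comp snd))))
  have hval : Primrec₂ fun (p : α × ℕ × ℕ) (v : List ℕ) =>
      if p.2.2 = 0 then p.2.1 else (v.head?.map Nat.succ).getD 0 :=
    ite (Primrec.eq.comp (snd.comp (snd.comp fst)) (const 0)) (fst.comp (snd.comp fst))
      (option_getD.comp (option_map (list_head?.comp snd) (succ.comp snd).to₂) (const 0))
  refine nat_omega_rec (fun (a : α) (b : ℕ × ℕ) => stageEmbedding (W a) b.1 b.2)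
    (m := fun _ b => b.2)
    (l := fun a b => (stageCall (W a) b.1 (Denumerable.ofNat (List ℕ) b.2)).toList)
    (g := fun a q => some (if q.1.2 = 0 then q.1.1 else (q.2.head?.map Nat.succ).getD 0))
    (snd.comp snd).to₂ (optionToList.comp hcall).to₂
    (option_some.comp (hval.comp (pair fst (fst.comp snd)) (snd.comp snd))).to₂ ?_ ?_
  · intro a b p hp
    exact lt_encode_of_mem_stageCall (Option.mem_toList.1 hp)
  · rintro a ⟨n, k⟩
    rcases eq_or_ne k 0 with rfl | hk
    · simp [stageEmbedding_zero]
    · simp only [if_neg hk, stageEmbedding_of_ne_zero _ _ hk]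
      cases stageCall (W a) n (Denumerable.ofNat (List ℕ) k) <;> rfl

/-! ## Oracle programs with a partial oracle -/

namespace OracleCode

/-- Evaluation of a program with a partial oracle. -/
def evalPart (O : ℕ →. ℕ) : OracleCode → ℕ →. ℕ
  | zero => pure 0
  | succ => Nat.succ
  | left => ↑fun n : ℕ => n.unpair.1
  | right => ↑fun n : ℕ => n.unpair.2
  | oracle => O
  | pair cf cg => fun n => Nat.pair <$> evalPart O cf n <*> evalPart O cg n
  | comp cf cg => fun n => evalPart O cg n >>= evalPart O cf
  | prec cf cg =>
    Nat.unpaired fun a n =>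
      n.rec (evalPart O cf a) fun y IH => do
        let i ← IH
        evalPart O cg (Nat.pair a (Nat.pair y i))
  | rfind' cf =>
    Nat.unpaired fun a m =>
      (Nat.rfind fun n => (fun m => m = 0) <$> evalPart O cf (Nat.pair a (n + m))).map (· + m)

theorem evalPart_coe (O : ℕ → ℕ) (c : OracleCode) : evalPart (O : ℕ →. ℕ) c = eval O c := by
  induction c with
  | zero | succ | left | right | oracle => rfl
  | pair cf cg hf hg | comp cf cg hf hg | prec cf cg hf hg => rw [evalPart, eval, hf, hg]
  | rfind' cf hf => rw [evalPart, eval, hf]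

/-- Continuity of evaluation in the oracle: if each value of the oracle `Q` is eventually a value
of `P i`, then so is each value computed from it. -/
theorem eventually_mem_evalPart {ι : Type*} {l : Filter ι} {P : ι → ℕ →. ℕ} {Q : ℕ →. ℕ}
    (h : ∀ x, ∀ y ∈ Q x, ∀ᶠ i in l, y ∈ P i x) (c : OracleCode) :
    ∀ x, ∀ y ∈ evalPart Q c x, ∀ᶠ i in l, y ∈ evalPart (P i) c x := by
  induction c with
  | zero | succ | left | right => exact fun x y hy => .of_forall fun _ => hy
  | oracle => exact h
  | pair cf cg hf hg =>
    intro x y hy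
    obtain ⟨_, h₁, h₂⟩ := Part.mem_bind_iff.1 hy
    obtain ⟨a, ha, rfl⟩ := (Part.mem_map_iff _).1 h₁
    obtain ⟨b, hb, rfl⟩ := (Part.mem_map_iff _).1 h₂
    filter_upwards [hf x a ha, hg x b hb] with i hia hib
    exact Part.mem_bind_iff.2 ⟨_, Part.mem_map _ hia, Part.mem_map _ hib⟩
  | comp cf cg hf hg =>
    intro x y hy
    obtain ⟨a, ha, hy⟩ := Part.mem_bind_iff.1 hy
    filter_upwards [hg x a ha, hf a y hy] with i hia hiy
    exact Part.mem_bind_iff.2 ⟨a, hia, hiy⟩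
  | prec cf cg hf hg =>
    intro x y hy
    simp only [evalPart, Nat.unpaired] at hy ⊢
    generalize x.unpair.2 = k at hy ⊢
    induction k generalizing y with
    | zero => exact hf _ y hy
    | succ k ih =>
      obtain ⟨a, ha, hy⟩ := Part.mem_bind_iff.1 hy
      filter_upwards [ih a ha, hg _ y hy] with i hia hiy
      exact Part.mem_bind_iff.2 ⟨a, hia, hiy⟩
  | rfind' cf hf =>
    intro x y hy
    obtain ⟨n, hn, rfl⟩ := (Part.mem_map_iff _).1 hy
    have hval : ∀ m b, b ∈ (fun m : ℕ => decide (m = 0)) <$>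
          evalPart Q cf (Nat.pair x.unpair.1 (m + x.unpair.2)) →
        ∀ᶠ i in l, b ∈ (fun m : ℕ => decide (m = 0)) <$>
          evalPart (P i) cf (Nat.pair x.unpair.1 (m + x.unpair.2)) := by
      intro m b hb
      obtain ⟨a, ha, rfl⟩ := (Part.mem_map_iff _).1 hb
      filter_upwards [hf _ a ha] with i hi using Part.mem_map _ hi
    -- An unbounded search that succeeds at `n` has made finitely many tests, so they are all
    -- eventually correct together.
    have hlt := (Set.finite_Iio n).eventually_all.2 fun m hm =>
      hval m false ((Nat.mem_rfind.1 hn).2 hm)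
    filter_upwards [hval n true (Nat.mem_rfind.1 hn).1, hlt] with i hi hi'
    exact Part.mem_map _ (Nat.mem_rfind.2 ⟨hi, fun hm => hi' _ hm⟩)

/-! ## Replacing the oracle by a program -/

/-- Replace the oracle by the program `L`. -/
def substOracle (L : Code) : OracleCode → Code
  | zero => .zero
  | succ => .succ
  | left => .left
  | right => .right
  | oracle => L
  | pair cf cg => .pair (substOracle L cf) (substOracle L cg)
  | comp cf cg => .comp (substOracle L cf) (substOracle L cg)
  | prec cf cg => .prec (substOracle L cf) (substOracle L cg)
  | rfind' cf => .rfind' (substOracle L cf)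

theorem eval_substOracle (L : Code) (c : OracleCode) :
    (substOracle L c).eval = evalPart L.eval c := by
  induction c with
  | zero | succ | left | right | oracle => rfl
  | pair cf cg hf hg | comp cf cg hf hg | prec cf cg hf hg =>
    rw [substOracle, evalPart, Code.eval, hf, hg]
  | rfind' cf hf => rw [substOracle, evalPart, Code.eval, hf]

theorem primrec_substOracle :
    Primrec₂ fun (L : Code) (n : ℕ) => substOracle L (Denumerable.ofNat OracleCode n) := by
  open Primrec in
  let node (l : List Code) (n : ℕ) : Code :=
    let m := n / 2 / 2
    let a := l.getD m.unpair.1 .zero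
    let b := l.getD m.unpair.2 .zero
    if n % 2 = 0 then if n / 2 % 2 = 0 then .pair a b else .comp a b
    else if n / 2 % 2 = 0 then .prec a b else .rfind' (l.getD m .zero)
  have hnode : Primrec₂ node := by
    have hn : Primrec fun p : List Code × ℕ => p.2 := snd
    have hn2 : Primrec fun p : List Code × ℕ => p.2 / 2 := nat_div.comp hn (const 2)
    have hm : Primrec fun p : List Code × ℕ => p.2 / 2 / 2 := nat_div.comp hn2 (const 2)
    have hu := Primrec.unpair.comp hm
    have ha := (list_getD Code.zero).comp fst (fst.comp hu)
    have hb := (list_getD Code.zero).comp fst (snd.comp hu)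
    have hc := (list_getD Code.zero).comp fst hm
    have e1 := Primrec.eq.comp (nat_mod.comp hn (const 2)) (const 0)
    have e2 := Primrec.eq.comp (nat_mod.comp hn2 (const 2)) (const 0)
    exact ite e1 (ite e2 (Code.primrec₂_pair.comp ha hb) (Code.primrec₂_comp.comp ha hb))
      (ite e2 (Code.primrec₂_prec.comp ha hb) (Code.primrec_rfind'.comp hc))
  -- In course-of-values recursion, the length of the list of earlier values is the number being
  -- decoded; numbers below `5` are the atomic programs, the last of them becoming `L`.
  let step (L : Code) (l : List Code) : Code :=
    [Code.zero, Code.succ, Code.left, Code.right, L].getD l.length (node l (l.length - 5))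
  have hstep : Primrec₂ step := by
    have hlen : Primrec fun p : Code × List Code => p.2.length := list_length.comp snd
    have hlist : Primrec fun p : Code × List Code =>
        [Code.zero, Code.succ, Code.left, Code.right, p.1] :=
      list_cons.comp (const _) (list_cons.comp (const _) (list_cons.comp (const _)
        (list_cons.comp (const _) (list_cons.comp fst (const [])))))
    refine (option_getD.comp (list_getElem?.comp hlist hlen)
      (hnode.comp snd (nat_sub.comp hlen (const 5)))).of_eq fun p => ?_
    rw [← List.getD_eq_getElem?_getD]
  refine nat_strong_rec _ (option_some.comp₂ hstep) fun L n => ?_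
  have hlen : ((List.range n).map fun k => substOracle L (Denumerable.ofNat OracleCode k)).length
      = n := by simp
  have hget : ∀ m < n, ((List.range n).map fun k =>
      substOracle L (Denumerable.ofNat OracleCode k)).getD m .zero = substOracle L (ofNatCode m) := by
    intro m hm
    simp [List.getD_eq_getElem?_getD, List.getElem?_range hm]
    rfl
  generalize ((List.range n).map fun k => substOracle L (Denumerable.ofNat OracleCode k)) = l at *
  change some (step L l) = some (substOracle L (ofNatCode n))
  simp only [step, hlen]
  match n, hget with
  | 0, _ | 1, _ | 2, _ | 3, _ | 4, _ => simp [ofNatCode, substOracle]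
  | n + 5, hget =>
    have hm : n / 2 / 2 < n + 5 := by omega
    have h1 := hget _ (lt_of_le_of_lt (Nat.unpair_left_le (n / 2 / 2)) hm)
    have h2 := hget _ (lt_of_le_of_lt (Nat.unpair_right_le (n / 2 / 2)) hm)
    have h3 := hget _ hm
    simp only [ofNatCode, Nat.div2_val]
    simp only [List.getD_eq_getElem?_getD] at h1 h2 h3 ⊢
    cases e1 : n.bodd <;> cases e2 : (n / 2).bodd <;>
      simp [node, Nat.mod_two_of_bodd, e1, e2, substOracle, h1, h2, h3, List.getD_eq_getElem?_getD]

/-! ## Approximating an oracle by its finite restrictions -/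

theorem exists_code_lookup :
    ∃ c : Code, ∀ (l : List ℕ) (x : ℕ), c.eval (Nat.pair (Encodable.encode l) x) = ↑l[x]? := by
  have h : Primrec fun n : ℕ => (Denumerable.ofNat (List ℕ) n.unpair.1)[n.unpair.2]? :=
    Primrec.list_getElem?.comp ((Primrec.ofNat _).comp (Primrec.fst.comp Primrec.unpair))
      (Primrec.snd.comp Primrec.unpair)
  obtain ⟨c, hc⟩ := Code.exists_code.1 (Partrec.nat_iff.1 h.to_comp.ofOption)
  exact ⟨c, fun l x => by simp [hc]⟩

/-- A program computing the finite partial function `x ↦ l[x]?`. -/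
noncomputable def lookupCode (l : List ℕ) : Code :=
  exists_code_lookup.choose.curry (Encodable.encode l)

theorem eval_lookupCode (l : List ℕ) (x : ℕ) : (lookupCode l).eval x = ↑l[x]? := by
  rw [lookupCode, Code.eval_curry, exists_code_lookup.choose_spec]

theorem primrec_lookupCode : Primrec lookupCode :=
  Code.primrec₂_curry.comp (Primrec.const _) Primrec.encode

/-- The first `k` values of `O`. -/
def initialValues (O : ℕ → ℕ) (k : ℕ) : List ℕ :=
  (List.range k).map O

theorem take_initialValues (O : ℕ → ℕ) {j k : ℕ} (h : j ≤ k) :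
    (initialValues O k).take j = initialValues O j := by
  rw [initialValues, initialValues, ← List.map_take, List.take_range, min_eq_left h]

theorem mem_eval_lookupCode {O : ℕ → ℕ} {k x y : ℕ} :
    y ∈ (lookupCode (initialValues O k)).eval x ↔ x < k ∧ y = O x := by
  rw [eval_lookupCode, Part.mem_ofOption, initialValues, List.getElem?_map, Option.mem_def]
  rcases lt_or_ge x k with h | h
  · simp [h, eq_comm]
  · simp [h.not_gt]

/-- The result, if any, of `r.unpair.1` steps of the program with number `n` on the input `m`,
when the oracle is restricted to the first `r.unpair.2` entries of `l`. -/
noncomputable def evalStage (l : List ℕ) (n m r : ℕ) : Option ℕ :=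
  (substOracle (lookupCode (l.take r.unpair.2)) (Denumerable.ofNat OracleCode n)).evaln r.unpair.1 m

theorem primrec_evalStage :
    Primrec fun p : List ℕ × ℕ × ℕ × ℕ => evalStage p.1 p.2.1 p.2.2.1 p.2.2.2 := by
  open Primrec in
  have hr : Primrec fun p : List ℕ × ℕ × ℕ × ℕ => p.2.2.2.unpair :=
    Primrec.unpair.comp (snd.comp (snd.comp snd))
  exact Code.primrec_evaln.comp (.pair (.pair (fst.comp hr)
    (primrec_substOracle.comp (primrec_lookupCode.comp (list_take.comp (snd.comp hr) fst))
      (fst.comp snd))) (fst.comp (snd.comp snd)))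

/-- Completeness is the use principle. Soundness holds because a restricted oracle diverges, rather
than answers wrongly, outside its domain. -/
theorem mem_eval_iff_exists_evalStage (O : ℕ → ℕ) (n m y : ℕ) :
    y ∈ (Denumerable.ofNat OracleCode n).eval O m ↔
      ∃ r, y ∈ evalStage (initialValues O r) n m r := by
  have hstage : ∀ r, evalStage (initialValues O r) n m r =
      (substOracle (lookupCode (initialValues O r.unpair.2))
        (Denumerable.ofNat OracleCode n)).evaln r.unpair.1 m := fun r => by
    rw [evalStage, take_initialValues O (Nat.unpair_right_le r)]
  simp only [hstage]
  constructor
  · intro h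
    rw [← evalPart_coe] at h
    have hev := eventually_mem_evalPart (l := Filter.atTop)
      (P := fun k => (lookupCode (initialValues O k)).eval) (Q := (O : ℕ →. ℕ))
      (fun x z hz => (Filter.eventually_gt_atTop x).mono fun k hk =>
        mem_eval_lookupCode.2 ⟨hk, Part.mem_some_iff.1 hz⟩) _ _ _ h
    obtain ⟨k, hk⟩ := hev.exists
    rw [← eval_substOracle] at hk
    obtain ⟨s, hs⟩ := Code.evaln_complete.1 hk
    exact ⟨Nat.pair s k, by simpa using hs⟩
  · rintro ⟨r, hr⟩
    have h := Code.evaln_sound hr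
    rw [eval_substOracle] at h
    -- Over a principal ultrafilter, continuity reduces to monotonicity in the oracle.
    have hev := eventually_mem_evalPart (l := pure ()) (P := fun _ => (O : ℕ →. ℕ))
      (fun x z hz => .of_forall fun _ => Part.mem_some_iff.2 (mem_eval_lookupCode.1 hz).2) _ _ _ h
    rw [← evalPart_coe]
    exact hev.exists.choose_spec

end OracleCode

/-! ## Relative computability of the restrictions of an oracle -/

theorem recursiveIn_encode_initialValues (O : ℕ → ℕ) :
    Nat.RecursiveIn {(O : ℕ →. ℕ)} fun k => Encodable.encode (OracleCode.initialValues O k) := by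
  have hcat : Nat.RecursiveIn {(O : ℕ →. ℕ)} fun p : ℕ =>
      (Encodable.encode (Denumerable.ofNat (List ℕ) p.unpair.1 ++ [p.unpair.2]) : ℕ) := by
    refine Nat.Primrec.recursiveIn (Primrec.nat_iff.1 (Primrec.encode.comp ?_))
    exact Primrec.list_concat.comp ((Primrec.ofNat _).comp (Primrec.fst.comp Primrec.unpair))
      (Primrec.snd.comp Primrec.unpair)
  -- The base value `0` is the code of the empty list; each step appends one oracle value.
  have hrec := Nat.RecursiveIn.prec Nat.RecursiveIn.zero
    (hcat.comp ((Nat.RecursiveIn.right.comp .right).pair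
      ((Nat.RecursiveIn.oracle (O : ℕ →. ℕ) (Set.mem_singleton _)).comp (Nat.RecursiveIn.left.comp .right))))
  have hzero : Nat.RecursiveIn {(O : ℕ →. ℕ)} fun k : ℕ => (Nat.pair 0 k : ℕ) :=
    Nat.Primrec.recursiveIn (Primrec.nat_iff.1 (Primrec₂.natPair.comp (.const 0) .id))
  refine (hrec.comp hzero).of_eq fun k => ?_
  simp only [Part.bind_eq_bind, Part.coe_some, Part.bind_some, Nat.unpair_pair]
  induction k with
  | zero => rfl
  | succ k ih =>
    simp only [ih]
    rw [show (Part.some k >>= (O : ℕ →. ℕ)) = Part.some (O k) from Part.bind_some _ _]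
    simp [Seq.seq, OracleCode.initialValues, List.range_succ]

theorem computableIn_comp_initialValues {O : ℕ → ℕ} {α : Type*} [Primcodable α]
    {f : List ℕ → α → ℕ} {k : α → ℕ} (hf : Primrec₂ f) (hk : Primrec k) :
    ComputableIn {(O : ℕ →. ℕ)} fun a => f (OracleCode.initialValues O (k a)) a := by
  -- The default `0` is harmless: `hF` diverges on numbers that code no element of `α`.
  have hK : Nat.RecursiveIn {(O : ℕ →. ℕ)} fun n : ℕ =>
      ((((Encodable.decode n : Option α).map k).getD 0 : ℕ) : Part ℕ) :=
    Nat.Primrec.recursiveIn (Primrec.nat_iff.1 (Primrec.option_getD.comp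
      (Primrec.option_map Primrec.decode (hk.comp Primrec.snd).to₂) (Primrec.const 0)))
  have hid : Nat.RecursiveIn {(O : ℕ →. ℕ)} fun n : ℕ => ((id n : ℕ) : Part ℕ) :=
    Nat.Primrec.recursiveIn (Primrec.nat_iff.1 .id)
  have hF : Nat.RecursiveIn {(O : ℕ →. ℕ)} fun p : ℕ =>
      (((Encodable.decode p.unpair.1 : Option α).map fun a =>
        f (Denumerable.ofNat (List ℕ) p.unpair.2) a : Option ℕ) : Part ℕ) := by
    refine Nat.Partrec.recursiveIn (Partrec.nat_iff.1 (Computable.ofOption (Primrec.to_comp ?_)))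
    open Primrec in
    exact option_map (Primrec.decode.comp (fst.comp unpair))
      (hf.comp ((Primrec.ofNat _).comp (snd.comp (unpair.comp fst))) snd).to₂
  refine (hF.comp (hid.pair ((recursiveIn_encode_initialValues O).comp hK))).of_eq fun n => ?_
  cases h : (Encodable.decode n : Option α) <;> simp [Seq.seq, h]

theorem mainTheorem9 :
    (∀ X : Set ℕ, ∃ F : ℕ → (ℕ → ℕ),
      ComputableIn₂ {((charFun X : ℕ → ℕ) : ℕ →. ℕ)} F ∧
      (kleeneOneRel X).IsEmbedding kleeneTwo F ∧
      ∀ (α : Ordinal.{u}) (s t : ClosedTerm ℕ),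
        (kleeneOneRel X).ExtEq α s t ↔ kleeneTwo.ExtEq α (s.map F) (t.map F)) ∧
    (∃ F : ℕ → (ℕ → ℕ),
      Computable₂ F ∧
      kleeneOne.IsEmbedding kleeneTwo F ∧
      ∀ (α : Ordinal.{u}) (s t : ClosedTerm ℕ),
        kleeneOne.ExtEq α s t ↔ kleeneTwo.ExtEq α (s.map F) (t.map F)) := by
  refine ⟨fun X => ?_, ?_⟩
  · let O := charFun X
    let W (n m r : ℕ) := OracleCode.evalStage (OracleCode.initialValues O r) n m r
    refine ⟨stageEmbedding W, ?_, kleeneTwo_embedding_of_app_eq (stageEmbedding_zero W)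
      (kleeneTwo_app_stageEmbedding (OracleCode.mem_eval_iff_exists_evalStage O))⟩
    -- Freezing the oracle at its first `k` values confines its use to a single parameter, in which
    -- everything else is primitive recursive.
    have hcongr : ∀ n k, stageEmbedding W n k =
        stageEmbedding (OracleCode.evalStage (OracleCode.initialValues O k)) n k := by
      refine fun n k => stageEmbedding_congr fun n m r hr => ?_
      simp only [W, OracleCode.evalStage, OracleCode.take_initialValues O (Nat.unpair_right_le r),
        OracleCode.take_initialValues O ((Nat.unpair_right_le r).trans hr)]
    simp only [ComputableIn₂, hcongr]
    exact computableIn_comp_initialValues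
      (f := fun l (p : ℕ × ℕ) => stageEmbedding (OracleCode.evalStage l) p.1 p.2)
      (primrec_stageEmbedding OracleCode.primrec_evalStage) Primrec.snd
  · let W (n m r : ℕ) := (Denumerable.ofNat Code n).evaln r m
    refine ⟨stageEmbedding W, ?_, kleeneTwo_embedding_of_app_eq (stageEmbedding_zero W)
      (kleeneTwo_app_stageEmbedding fun n m y => Code.evaln_complete)⟩
    have hW : Primrec fun p : Unit × ℕ × ℕ × ℕ => W p.2.1 p.2.2.1 p.2.2.2 := by
      open Primrec in
      exact Code.primrec_evaln.comp (pair (pair (snd.comp (snd.comp snd))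
        ((Primrec.ofNat Code).comp (fst.comp snd))) (fst.comp (snd.comp snd)))
    exact ((primrec_stageEmbedding (W := fun _ => W) hW).comp
      (Primrec.pair (Primrec.const ()) Primrec.id)).to_comp
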